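/- **Setting.** A set of $m$ indivisible chores $c_1,\dots,c_m$ is to be divided among $n\ge 1$ agents; agent $i$ has a positive cost $v_i(c)$ for each chore $c$, and $v_i(S)=\sum_{c\in S}v_i(c)$ for a set $S$ of chores. The maximin share of agent $i$ is $\mu_i=\min_{(S_1,\dots,S_n)}\max_j v_i(S_j)$, the minimum being over all partitions of the chores into $n$ (possibly empty) bundles. An allocation $(A_1,\dots,A_n)$ gives each chore to exactly one agent; it is $\alpha$-MMS if $v_i(A_i)\le\alpha\mu_i$ for all $i$. The instance is personalized bivalued if for each $i$ there are $a_i,b_i>0$ with $v_i(c)\in\{a_i,b_i\}$ for all $c$. It is ordered (has identical order preferences) if $v_i(c_1)\ge\dots\ge v_i(c_m)$ for all $i$. **The algorithm HFFD** (heterogeneous first fit decreasing), on an ordered instance with thresholds $\tau_1,\dots,\tau_n\in\mathbb R$, fills one bin at a time. It starts with an empty bin $B$ and scans the remaining chores in the order $c_1,\dots,c_m$; a chore $c$ is added to $B$ if $v_i(B\cup\{c\})\le\tau_i$ for at least one remaining agent $i$, and is skipped otherwise. After the scan, if $B\ne\emptyset$, the bin is given to an arbitrary remaining agent $i$ with $v_i(B)\le\tau_i$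 (that is, one for whom the last chore fitted); this agent and the chores of $B$ are removed, and the next bin is filled. The algorithm stops when the bin remains empty (in particular when no agent or no chore remains). It succeeds if all chores have been allocated, and fails otherwise. **Theorem.** 1. For every ordered personalized bivalued instance and all thresholds $\tau_i\ge\frac{15}{13}\mu_i$, HFFD succeeds, however it chooses the agents who receive the bins, and outputs an allocation with $v_i(A_i)\le\tau_i$ for all $i$. In particular, with $\tau_i=\frac{15}{13}\mu_i$ it always outputs a $\frac{15}{13}$-MMS allocation. 2. Consequently every personalized bivalued instance, ordered or not, has a $\frac{15}{13}$-MMS allocation. 3. The ratio is tight: there is an ordered instance with $3$ agents who all have the same cost function, with chore costs in $\{a,b\}$ for some positive rationals $a,b$, such that, with $\mu$ the common maximin share, HFFD fails in every run for all thresholds with $\tau_i<\frac{15}{13}\mu$ for all $i$; moreover, for arbitrary thresholds, every successful run of HFFD gives some agent a bundle of cost at least $\frac{15}{13}\mu$. -/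

import Mathlib

open scoped BigOperators

namespace Chores

noncomputable section

/-- Additive cost of a bundle `S` under the chore costs `w`. -/
def cost {m : ℕ} (w : Fin m → ℝ) (S : Finset (Fin m)) : ℝ := ∑ c ∈ S, w c

/-- The maximin share for `d` bundles: the minimum over all partitions of the chores into
`d` (possibly empty) bundles of the largest bundle cost.  A partition is given by the map `p`
sending each chore to its bundle.  For `d ≥ 1` both extrema range over finite nonempty sets. -/
def mms {m : ℕ} (d : ℕ) (w : Fin m → ℝ) : ℝ :=
  ⨅ p : Fin m → Fin d, ⨆ j : Fin d, cost w (Finset.univ.filter fun c => p c = j)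

/-- Every agent's chore costs take (at most) two values, both positive. -/
def IsPersonalizedBivalued {n m : ℕ} (v : Fin n → Fin m → ℝ) : Prop :=
  ∀ i, ∃ a b : ℝ, 0 < a ∧ 0 < b ∧ ∀ c, v i c = a ∨ v i c = b

/-- Identical order preferences; the chores are indexed by the universal ordering,
from the largest cost to the smallest. -/
def IsIDO {n m : ℕ} (v : Fin n → Fin m → ℝ) : Prop :=
  ∀ i, Antitone (v i)

/-- Every chore is given to exactly one agent. -/
def IsAllocation {n m : ℕ} (A : Fin n → Finset (Fin m)) : Prop :=
  ∀ c, ∃! i, c ∈ A i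

/-- The cost of each agent's bundle is at most `α` times the agent's maximin share. -/
def IsApproxMMS {n m : ℕ} (α : ℝ) (v : Fin n → Fin m → ℝ) (A : Fin n → Finset (Fin m)) : Prop :=
  ∀ i, cost (v i) (A i) ≤ α * mms n (v i)

open Classical in
/-- Scan a list of chores, starting from the current content `B` of the bin: a chore is added
if the bin including it is within the threshold of at least one of the remaining agents `R`,
and is skipped otherwise. -/
def fillBin {n m : ℕ} (v : Fin n → Fin m → ℝ) (τ : Fin n → ℝ) (R : Finset (Fin n)) :
    List (Fin m) → Finset (Fin m) → Finset (Fin m)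
  | [], B => B
  | c :: l, B =>
    if ∃ i ∈ R, cost (v i) (insert c B) ≤ τ i then fillBin v τ R l (insert c B)
    else fillBin v τ R l B

/-- The next bin, when `R` is the set of remaining agents and `U` the set of remaining chores:
the chores of `U` are scanned in the universal ordering, starting with an empty bin. -/
def nextBin {n m : ℕ} (v : Fin n → Fin m → ℝ) (τ : Fin n → ℝ)
    (R : Finset (Fin n)) (U : Finset (Fin m)) : Finset (Fin m) :=
  fillBin v τ R (U.sort (· ≤ ·)) ∅

/-- `HFFDFrom v τ R U A W`: started with remaining agents `R` and remaining chores `U`, the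
heterogeneous first-fit-decreasing procedure can stop having given bundle `A i` to each agent `i`
and having left the chores `W` unallocated.  A closed bin goes to any remaining agent for whom
its last chore fitted, that is, for whom the whole bin is within the threshold.  The procedure
stops when no remaining chore fits an empty bin of a remaining agent; in particular when no
chore or no agent remains. -/
inductive HFFDFrom {n m : ℕ} (v : Fin n → Fin m → ℝ) (τ : Fin n → ℝ) :
    Finset (Fin n) → Finset (Fin m) → (Fin n → Finset (Fin m)) → Finset (Fin m) → Prop
  | halt (R : Finset (Fin n)) (U : Finset (Fin m)) (h : nextBin v τ R U = ∅) :
      HFFDFrom v τ R U (fun _ => ∅) U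
  | step (R : Finset (Fin n)) (U : Finset (Fin m)) (A : Fin n → Finset (Fin m))
      (W : Finset (Fin m)) (i : Fin n) (hi : i ∈ R) (hne : (nextBin v τ R U).Nonempty)
      (hfit : cost (v i) (nextBin v τ R U) ≤ τ i)
      (h : HFFDFrom v τ (R.erase i) (U \ nextBin v τ R U) A W) :
      HFFDFrom v τ R U (Function.update A i (nextBin v τ R U)) W

/-- `HFFD v τ A W`: some run of the algorithm on all agents and all chores with costs `v` and
thresholds `τ` outputs the bundles `A` and leaves the chores `W` unallocated.
The run succeeds if `W = ∅` and fails otherwise. -/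
def HFFD {n m : ℕ} (v : Fin n → Fin m → ℝ) (τ : Fin n → ℝ)
    (A : Fin n → Finset (Fin m)) (W : Finset (Fin m)) : Prop :=
  HFFDFrom v τ Finset.univ Finset.univ A W

end

end Chores

namespace Chores

/-! A failing run has exhausted the agents, because thresholds of at least `15/13 * mms` let every
single chore fit an empty bin. So some agent `i` is present while all `n` bins are filled, and every
chore left over was refused by each bin on `i`'s terms. It remains to contradict this from the
viewpoint of `i` alone.

Let `a ≥ b` be the two costs of agent `i`, `p` the number of large chores that fit into `τ`, `q` the
number of small chores that fit on top of those `p`, and `t` the number of small chores that fit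
alone. If a large chore is left, each bin holds at least `p` of them, whereas each bundle of an
optimal partition holds at most `p`.

If a small chore is left, give each large chore weight `d = t - q` and each small one weight `p`:
the linear function that takes the value `p * t` on both extreme bins, `(p, q)` and `(0, t)`. Every
bin then weighs at least `p * t`, except possibly the one in which the large chores run out, which
loses less than `p`; the leftover chore, of weight `p`, makes up for it (`weight_of_full_bin`,
`Serves.mul_lt_weight`). So the total weight exceeds `n * p * t`. But a bundle of cost at most
`13/15 * τ` weighs at most `p * t` (`weight_le_of_scaled`), and an optimal partition bounds the
total by `n * p * t`. The constant `15/13` is needed only in this last inequality.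

Unordered instances reduce to ordered ones by matching sorted positions to chores with Hall's
theorem. For tightness, three chores of cost 4 and nine of cost 3 have maximin share 13, but HFFD
packs the 4s together, and then all bundle costs are multiples of 3. -/

variable {n m : ℕ}

/-! ### Weight of a bundle within 13/15 of the threshold -/

/-- The finitely many small bundles for which the number of chores alone does not give the weight
inequality. -/
lemma weight_le_of_small {a τ : ℝ} (ha : 0 ≤ a) {p q t x u : ℕ} (hxu : x + u ≤ 6) (hxut : x + u ≤ t)
    (hc : p + q < x + u) (hxp : x ≤ p)
    (hp' : τ < (p + 1) * a) (hq : q ≤ τ - p * a) (hq' : τ - p * a < q + 1)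
    (ht' : τ < t + 1) (h : 15 / 13 * (x * a + u) ≤ τ) :
    p * u + t * x ≤ p * t + q * x := by
  by_contra! hcon
  have hx1 : 1 ≤ x := by
    rcases Nat.eq_zero_or_pos x with rfl | h0
    · have := Nat.mul_le_mul_left p (show u ≤ t by omega)
      omega
    · exact h0
  have hxp : x < p := by
    refine lt_of_le_of_ne hxp ?_
    rintro rfl
    have huq : (u : ℝ) < (q + 1 : ℕ) := by
      push_cast
      have : (0 : ℝ) ≤ x * a + u := by positivity
      linarith
    have := Nat.mul_le_mul_left x (Nat.lt_succ_iff.1 (by exact_mod_cast huq))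
    linarith
  have hp5 : p ≤ 5 := by omega
  have hx4 : x ≤ 4 := by omega
  have hu5 : u ≤ 5 := by omega
  have hq3 : q ≤ 3 := by omega
  -- Since `x < p`, the negated inequality bounds `t` once the other numbers are fixed; what
  -- survives is linear in `a` and `τ`. The ratio is sharp at `x = 1`, `u = 3`, `p = 3`, `q = 0`, `t
  -- = 4`, where the bounds meet only in the limit `a = 4/3`, `τ = 5`.
  interval_cases x <;> interval_cases p <;>
    interval_cases u <;> (try omega) <;>
    interval_cases q <;> (try omega) <;>
    (have ht35 : t ≤ 35 := by omega) <;>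
    interval_cases t <;> (try omega) <;>
    (exfalso; push_cast at hp' hq hq' ht' h; linarith)

/-- Floors of a threshold satisfy the weight inequality for every bundle of `x` large chores
of cost `a` and `u` small chores of cost `1` that is within `13 / 15` of the threshold. -/
lemma weight_le_of_scaled {a τ : ℝ} (ha : 1 ≤ a) {p q t x u : ℕ}
    (hp' : τ < (p + 1) * a) (hq : q ≤ τ - p * a) (hq' : τ - p * a < q + 1)
    (ht' : τ < t + 1) (h : 15 / 13 * (x * a + u) ≤ τ) :
    p * u + t * x ≤ p * t + q * x := by
  have hx0 : (0 : ℝ) ≤ x := x.cast_nonneg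
  have hu0 : (0 : ℝ) ≤ u := u.cast_nonneg
  have hxa : (x : ℝ) ≤ x * a := le_mul_of_one_le_right hx0 ha
  have hxp : x ≤ p := by
    have : (x : ℝ) * a < (p + 1) * a := by linarith
    have : (x : ℝ) < p + 1 := lt_of_mul_lt_mul_right this (by linarith)
    exact Nat.lt_succ_iff.1 (by exact_mod_cast this)
  -- From cost `13/2` on, the ratio leaves a slack of `2/13 * 13/2 = 1` below `τ`. Multiplied by
  -- `p`, it pays for rounding down to `t` and `q`, which loses at most `(p - x) + x`.
  rcases le_or_gt (13 / 2 : ℝ) (x * a + u) with hbig | hsmall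
  · have hxp' : (x : ℝ) ≤ p := by exact_mod_cast hxp
    have h1 : (p : ℝ) * 1 ≤ p * (τ - (x * a + u)) :=
      mul_le_mul_of_nonneg_left (by linarith) p.cast_nonneg
    have h2 : ((p : ℝ) - x) * (τ - t) ≤ (p - x) * 1 :=
      mul_le_mul_of_nonneg_left (by linarith) (by linarith)
    have h3 : (x : ℝ) * (τ - p * a - q) ≤ x * 1 :=
      mul_le_mul_of_nonneg_left (by linarith) hx0
    have : (p : ℝ) * u + t * x ≤ p * t + q * x := by linarith
    exact_mod_cast this
  · have hxut : x + u ≤ t := by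
      have : ((x + u : ℕ) : ℝ) < (t + 1 : ℕ) := by push_cast; linarith
      exact Nat.lt_succ_iff.1 (by exact_mod_cast this)
    have hxu : x + u ≤ 6 := by
      have : ((x + u : ℕ) : ℝ) < (7 : ℕ) := by push_cast; linarith
      exact Nat.lt_succ_iff.1 (by exact_mod_cast this)
    rcases le_or_gt (x + u) (p + q) with hc | hc
    · zify at *
      -- The goal rearranges to `x * (u - q) ≤ (p - x) * (t - u)`, which is compared factor by
      -- factor.
      rcases le_total (q : ℤ) u with hqu | hqu
      · have := mul_le_mul (show (u : ℤ) - q ≤ p - x by linarith)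
          (show (x : ℤ) ≤ t - u by linarith) (by positivity) (by linarith)
        linarith
      · have h1 := mul_nonneg (show (0 : ℤ) ≤ p - x by linarith) (show (0 : ℤ) ≤ t - u by linarith)
        have h2 := mul_nonneg (show (0 : ℤ) ≤ x by positivity) (show (0 : ℤ) ≤ q - u by linarith)
        linarith
    · exact weight_le_of_small (by linarith) hxu hxut hc hxp hp' hq hq' ht' h

/-! ### Costs and numbers of large and small chores -/

lemma cost_mono {w : Fin m → ℝ} (hw : ∀ c, 0 ≤ w c) {S T : Finset (Fin m)} (h : S ⊆ T) :
    cost w S ≤ cost w T :=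
  Finset.sum_le_sum_of_subset_of_nonneg h fun c _ _ => hw c

lemma cost_nonneg {w : Fin m → ℝ} (hw : ∀ c, 0 ≤ w c) (S : Finset (Fin m)) : 0 ≤ cost w S :=
  Finset.sum_nonneg fun c _ => hw c

lemma cost_empty (w : Fin m → ℝ) : cost w ∅ = 0 := Finset.sum_empty

lemma cost_insert {w : Fin m → ℝ} {c : Fin m} {S : Finset (Fin m)} (h : c ∉ S) :
    cost w (insert c S) = w c + cost w S := Finset.sum_insert h

/-- Number of chores of cost `a`. -/
noncomputable def numLarge (w : Fin m → ℝ) (a : ℝ) (S : Finset (Fin m)) : ℕ :=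
  (S.filter fun c => w c = a).card

/-- Number of chores of cost different from `a`. -/
noncomputable def numSmall (w : Fin m → ℝ) (a : ℝ) (S : Finset (Fin m)) : ℕ :=
  (S.filter fun c => w c ≠ a).card

lemma cost_eq {w : Fin m → ℝ} {a b : ℝ} (h : ∀ c, w c = a ∨ w c = b) (S : Finset (Fin m)) :
    cost w S = numLarge w a S * a + numSmall w a S * b := by
  rw [cost, ← Finset.sum_filter_add_sum_filter_not S (fun c => w c = a), numLarge, numSmall]
  congr 1
  · rw [Finset.sum_congr rfl fun c hc => (Finset.mem_filter.1 hc).2]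
    simp
  · rw [Finset.sum_congr rfl fun c hc => (h c).resolve_left (Finset.mem_filter.1 hc).2]
    simp

lemma numLarge_add_sdiff (w : Fin m → ℝ) (a : ℝ) {S T : Finset (Fin m)} (h : S ⊆ T) :
    numLarge w a S + numLarge w a (T \ S) = numLarge w a T := by
  rw [numLarge, numLarge, numLarge, ← Finset.card_union_of_disjoint, ← Finset.filter_union,
    Finset.union_sdiff_of_subset h]
  exact Finset.disjoint_filter_filter Finset.disjoint_sdiff

lemma numSmall_add_sdiff (w : Fin m → ℝ) (a : ℝ) {S T : Finset (Fin m)} (h : S ⊆ T) :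
    numSmall w a S + numSmall w a (T \ S) = numSmall w a T := by
  rw [numSmall, numSmall, numSmall, ← Finset.card_union_of_disjoint, ← Finset.filter_union,
    Finset.union_sdiff_of_subset h]
  exact Finset.disjoint_filter_filter Finset.disjoint_sdiff

/-! ### Bins -/

lemma subset_fillBin (v : Fin n → Fin m → ℝ) (τ : Fin n → ℝ) (R : Finset (Fin n))
    (l : List (Fin m)) (B : Finset (Fin m)) : B ⊆ fillBin v τ R l B := by
  induction l generalizing B with
  | nil => exact subset_rfl
  | cons c l ih =>
    rw [fillBin]
    split_ifs
    · exact (Finset.subset_insert c B).trans (ih _)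
    · exact ih _

lemma fillBin_subset (v : Fin n → Fin m → ℝ) (τ : Fin n → ℝ) (R : Finset (Fin n))
    (l : List (Fin m)) (B : Finset (Fin m)) : fillBin v τ R l B ⊆ B ∪ l.toFinset := by
  induction l generalizing B with
  | nil => simp [fillBin]
  | cons c l ih =>
    rw [fillBin]
    split_ifs
    · refine (ih _).trans ?_
      intro d
      simp only [Finset.mem_union, Finset.mem_insert, List.mem_toFinset, List.mem_cons]
      tauto
    · refine (ih _).trans ?_
      intro d
      simp only [Finset.mem_union, List.mem_toFinset, List.mem_cons]
      tauto

lemma fillBin_eq_or_exists_cost_le (v : Fin n → Fin m → ℝ) (τ : Fin n → ℝ) (R : Finset (Fin n))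
    (l : List (Fin m)) (B : Finset (Fin m)) :
    fillBin v τ R l B = B ∨ ∃ i ∈ R, cost (v i) (fillBin v τ R l B) ≤ τ i := by
  induction l generalizing B with
  | nil => exact Or.inl rfl
  | cons c l ih =>
    rw [fillBin]
    split_ifs with h
    · rcases ih (insert c B) with h' | h'
      · rw [h']
        exact Or.inr h
      · exact Or.inr h'
    · exact ih _

/-- A scanned chore that was skipped did not fit with the part of the bin that precedes it. -/
lemma lt_cost_of_notMem_fillBin {v : Fin n → Fin m → ℝ} {τ : Fin n → ℝ} {R : Finset (Fin n)}
    {i : Fin n} (hi : i ∈ R) {l : List (Fin m)} (hl : l.Pairwise (· < ·)) {B : Finset (Fin m)}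
    (hB : ∀ d ∈ B, ∀ c ∈ l, d < c) {c : Fin m} (hc : c ∈ l) (hcB : c ∉ fillBin v τ R l B) :
    τ i < cost (v i) (insert c ((fillBin v τ R l B).filter (· < c))) := by
  induction l generalizing B with
  | nil => simp at hc
  | cons e l ih =>
    rw [List.pairwise_cons] at hl
    rw [fillBin] at hcB ⊢
    split_ifs at hcB ⊢ with h
    · rcases List.mem_cons.1 hc with rfl | hc
      · exact absurd (subset_fillBin v τ R l _ (Finset.mem_insert_self c B)) hcB
      · refine ih hl.2 ?_ hc hcB
        intro d hd c' hc'
        rcases Finset.mem_insert.1 hd with rfl | hd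
        · exact hl.1 _ hc'
        · exact hB d hd c' (List.mem_cons_of_mem _ hc')
    · rcases List.mem_cons.1 hc with rfl | hc
      · push Not at h
        -- Chores scanned later come after `c`, so the part of the final bin before `c` is what the
        -- bin held when `c` was scanned.
        have hfil : (fillBin v τ R l B).filter (· < c) = B := by
          ext d
          rw [Finset.mem_filter]
          constructor
          · rintro ⟨hd, hdc⟩
            rcases Finset.mem_union.1 (fillBin_subset v τ R l B hd) with hd | hd
            · exact hd
            · exact absurd hdc (hl.1 d (List.mem_toFinset.1 hd)).not_gt
          · intro hd
            exact ⟨subset_fillBin v τ R l B hd, hB d hd c List.mem_cons_self⟩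
        rw [hfil]
        exact h i hi
      · exact ih hl.2 (fun d hd c' hc' => hB d hd c' (List.mem_cons_of_mem _ hc')) hc hcB

lemma nextBin_subset (v : Fin n → Fin m → ℝ) (τ : Fin n → ℝ) (R : Finset (Fin n))
    (U : Finset (Fin m)) : nextBin v τ R U ⊆ U := by
  simpa [nextBin] using fillBin_subset v τ R (U.sort (· ≤ ·)) ∅

lemma nextBin_eq_empty_or_exists_cost_le (v : Fin n → Fin m → ℝ) (τ : Fin n → ℝ)
    (R : Finset (Fin n)) (U : Finset (Fin m)) :
    nextBin v τ R U = ∅ ∨ ∃ i ∈ R, cost (v i) (nextBin v τ R U) ≤ τ i :=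
  fillBin_eq_or_exists_cost_le v τ R _ ∅

lemma lt_cost_of_notMem_nextBin {v : Fin n → Fin m → ℝ} {τ : Fin n → ℝ} {R : Finset (Fin n)}
    {i : Fin n} (hi : i ∈ R) {U : Finset (Fin m)} {c : Fin m} (hc : c ∈ U)
    (hcB : c ∉ nextBin v τ R U) :
    τ i < cost (v i) (insert c ((nextBin v τ R U).filter (· < c))) := by
  refine lt_cost_of_notMem_fillBin hi (Finset.sortedLT_sort U).pairwise (by simp) ?_ hcB
  simpa using hc

/-- A skipped chore would have brought the bin over the threshold of each remaining agent. -/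
lemma lt_cost_nextBin_add {v : Fin n → Fin m → ℝ} {τ : Fin n → ℝ} {R : Finset (Fin n)}
    {i : Fin n} (hi : i ∈ R) (hv : ∀ c, 0 ≤ v i c) {U : Finset (Fin m)} {c : Fin m} (hc : c ∈ U)
    (hcB : c ∉ nextBin v τ R U) : τ i < cost (v i) (nextBin v τ R U) + v i c := by
  have h := lt_cost_of_notMem_nextBin hi hc hcB
  rw [cost_insert (by simp)] at h
  linarith [cost_mono hv (Finset.filter_subset (· < c) (nextBin v τ R U))]

/-- If a chore of the largest cost was skipped, the bin holds as many chores of that cost as the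
threshold allows. -/
lemma lt_numLarge_add_one_mul {v : Fin n → Fin m → ℝ} {τ : Fin n → ℝ} {R : Finset (Fin n)}
    {i : Fin n} (hi : i ∈ R) (hv : Antitone (v i)) {a : ℝ} (ha : 0 ≤ a) (hva : ∀ c, v i c ≤ a)
    {U : Finset (Fin m)} {c : Fin m} (hca : v i c = a) (hc : c ∈ U)
    (hcB : c ∉ nextBin v τ R U) : τ i < (numLarge (v i) a (nextBin v τ R U) + 1) * a := by
  have h := lt_cost_of_notMem_nextBin hi hc hcB
  rw [cost_insert (by simp), hca] at h
  have hlarge : ∀ d ∈ (nextBin v τ R U).filter (· < c), v i d = a := fun d hd =>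
    le_antisymm (hva d) (hca ▸ hv (Finset.mem_filter.1 hd).2.le)
  have hcard : ((nextBin v τ R U).filter (· < c)).card ≤ numLarge (v i) a (nextBin v τ R U) :=
    Finset.card_le_card fun d hd =>
      Finset.mem_filter.2 ⟨(Finset.mem_filter.1 hd).1, hlarge d hd⟩
  have hcost : cost (v i) ((nextBin v τ R U).filter (· < c))
      = ((nextBin v τ R U).filter (· < c)).card * a := by
    rw [cost, Finset.sum_congr rfl hlarge]
    simp
  have := mul_le_mul_of_nonneg_right (Nat.cast_le (α := ℝ).2 hcard) ha
  linarith

/-! ### Runs -/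

lemma HFFDFrom.subset {v : Fin n → Fin m → ℝ} {τ : Fin n → ℝ} {R : Finset (Fin n)}
    {U W : Finset (Fin m)} {A : Fin n → Finset (Fin m)} (h : HFFDFrom v τ R U A W) :
    W ⊆ U ∧ ∀ i, A i ⊆ U := by
  induction h with
  | halt R U h => simp
  | step R U A W i hi hne hfit h ih =>
    refine ⟨ih.1.trans Finset.sdiff_subset, fun j => ?_⟩
    rcases eq_or_ne j i with rfl | hj
    · simpa using nextBin_subset v τ R U
    · rw [Function.update_of_ne hj]
      exact (ih.2 j).trans Finset.sdiff_subset

lemma HFFDFrom.eq_empty_or_cost_le {v : Fin n → Fin m → ℝ} {τ : Fin n → ℝ} {R : Finset (Fin n)}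
    {U W : Finset (Fin m)} {A : Fin n → Finset (Fin m)} (h : HFFDFrom v τ R U A W) (j : Fin n) :
    A j = ∅ ∨ j ∈ R ∧ cost (v j) (A j) ≤ τ j := by
  induction h with
  | halt R U h => simp
  | step R U A W i hi hne hfit h ih =>
    rcases eq_or_ne j i with rfl | hj
    · exact Or.inr ⟨hi, by simpa using hfit⟩
    · rw [Function.update_of_ne hj]
      exact ih.imp_right fun ⟨h1, h2⟩ => ⟨Finset.mem_of_mem_erase h1, h2⟩

lemma HFFDFrom.existsUnique {v : Fin n → Fin m → ℝ} {τ : Fin n → ℝ} {R : Finset (Fin n)}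
    {U W : Finset (Fin m)} {A : Fin n → Finset (Fin m)} (h : HFFDFrom v τ R U A W) {c : Fin m}
    (hc : c ∈ U) (hcW : c ∉ W) : ∃! i, c ∈ A i := by
  induction h with
  | halt R U h => exact absurd hc hcW
  | step R U A W i hi hne hfit h ih =>
    by_cases hcB : c ∈ nextBin v τ R U
    · refine ⟨i, by simpa using hcB, fun j hj => ?_⟩
      by_contra hji
      simp only [Function.update_of_ne hji] at hj
      exact (Finset.mem_sdiff.1 (h.subset.2 j hj)).2 hcB
    · obtain ⟨j, hj, huniq⟩ := ih (Finset.mem_sdiff.2 ⟨hc, hcB⟩) hcW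
      have hji : j ≠ i := by
        rintro rfl
        have := (h.eq_empty_or_cost_le j).resolve_right (by simp)
        simp [this] at hj
      refine ⟨j, by simpa [Function.update_of_ne hji] using hj, fun k hk => ?_⟩
      rcases eq_or_ne k i with rfl | hki
      · simp only [Function.update_self] at hk
        exact absurd hk hcB
      · simp only [Function.update_of_ne hki] at hk
        exact huniq k hk

lemma exists_hffdFrom (v : Fin n → Fin m → ℝ) (τ : Fin n → ℝ) (R : Finset (Fin n))
    (U : Finset (Fin m)) : ∃ A W, HFFDFrom v τ R U A W := by
  induction R using Finset.strongInduction generalizing U with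
  | H R ih =>
    rcases (nextBin v τ R U).eq_empty_or_nonempty with h | h
    · exact ⟨_, _, .halt R U h⟩
    · obtain ⟨i, hi, hfit⟩ :=
        (nextBin_eq_empty_or_exists_cost_le v τ R U).resolve_left h.ne_empty
      obtain ⟨A, W, hA⟩ := ih _ (Finset.erase_ssubset hi) (U \ nextBin v τ R U)
      exact ⟨_, _, .step R U A W i hi h hfit hA⟩

/-! ### Bins filled while one agent remains -/

/-- `Serves v τ i k U W`: while agent `i` remains, `k` bins can be filled from the chores `U`,
leaving the chores `W`. -/
inductive Serves (v : Fin n → Fin m → ℝ) (τ : Fin n → ℝ) (i : Fin n) :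
    ℕ → Finset (Fin m) → Finset (Fin m) → Prop
  | zero (U : Finset (Fin m)) : Serves v τ i 0 U U
  | succ (k : ℕ) (R : Finset (Fin n)) (U W : Finset (Fin m)) (hi : i ∈ R)
      (h : Serves v τ i k (U \ nextBin v τ R U) W) : Serves v τ i (k + 1) U W

/-- A failing run leaves no agent, so all its bins are filled while the last agent remains. -/
lemma HFFDFrom.exists_serves {v : Fin n → Fin m → ℝ} {τ : Fin n → ℝ} {R : Finset (Fin n)}
    {U W : Finset (Fin m)} {A : Fin n → Finset (Fin m)} (h : HFFDFrom v τ R U A W)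
    (hfit : ∀ i c, v i c ≤ τ i) (hW : W.Nonempty) (hR : R.Nonempty) :
    ∃ i ∈ R, Serves v τ i R.card U W := by
  induction h with
  | halt R U h =>
    obtain ⟨i, hi⟩ := hR
    obtain ⟨c, hc⟩ := hW
    have := lt_cost_of_notMem_nextBin (v := v) (τ := τ) hi hc (by simp [h])
    simp only [h, Finset.filter_empty, cost_insert (Finset.notMem_empty c), cost_empty] at this
    linarith [hfit i c]
  | step R U A W i hi hne hcost h ih =>
    have hcard := Finset.card_erase_add_one hi
    rcases (R.erase i).eq_empty_or_nonempty with h0 | h0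
    · refine ⟨i, hi, ?_⟩
      rw [← hcard, h0]
      have hWU : W = U \ nextBin v τ R U := by
        rw [h0] at h
        cases h with
        | halt => rfl
        | step _ _ _ _ j hj => simp at hj
      rw [hWU]
      exact .succ 0 R U _ hi (.zero _)
    · obtain ⟨j, hj, hs⟩ := ih hW h0
      refine ⟨j, Finset.mem_of_mem_erase hj, ?_⟩
      rw [← hcard]
      exact .succ _ R U W (Finset.mem_of_mem_erase hj) hs

lemma Serves.subset {v : Fin n → Fin m → ℝ} {τ : Fin n → ℝ} {i : Fin n} {k : ℕ}
    {U W : Finset (Fin m)} (h : Serves v τ i k U W) : W ⊆ U := by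
  induction h with
  | zero => exact subset_rfl
  | succ k R U W hi h ih => exact ih.trans Finset.sdiff_subset

/-- Weights of a bin with `x` large and `y` small chores into which no further small chore fits. -/
lemma weight_of_full_bin {a τ : ℝ} {p q t d x y : ℕ} (hp1 : 1 ≤ p)
    (hp' : τ < (p + 1) * a) (hq : q ≤ τ - p * a) (ht : t ≤ τ) (ht' : τ < t + 1) (hd : t = q + d)
    (hfull : τ < x * a + (y + 1)) :
    (p ≤ x ∨ x = 0 → p * t ≤ d * x + p * y) ∧ p * t < d * x + p * y + p := by
  have key : p ≤ x ∨ x = 0 → p * t ≤ d * x + p * y := by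
    rintro (h | rfl)
    · rcases h.eq_or_lt with rfl | h
      · have : (q : ℝ) < (y + 1 : ℕ) := by push_cast; linarith
        have := Nat.mul_le_mul_left p (Nat.lt_succ_iff.1 (by exact_mod_cast this : q < y + 1))
        rw [hd]
        linarith
      -- Here `x > p`, possible because the bin need only fit some remaining agent. From `q ≤ a`
      -- follows `(p + 1) * q ≤ p * a + q ≤ τ`, hence `p * q ≤ d`, and `p + 1` large chores alone
      -- weigh enough.
      · have hqa : (q : ℝ) ≤ a := by linarith
        have h1 := mul_le_mul_of_nonneg_left hqa (Nat.cast_nonneg (α := ℝ) p)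
        have h2 : ((p * q + q : ℕ) : ℝ) < (t + 1 : ℕ) := by push_cast; linarith
        have h3 : p * q + q ≤ t := Nat.lt_succ_iff.1 (by exact_mod_cast h2)
        have h4 := Nat.mul_le_mul_left d (Nat.succ_le_of_lt h)
        have h5 : p * t = p * q + p * d := by rw [hd]; ring
        have h6 : d * p.succ = p * d + d := by rw [Nat.succ_eq_add_one]; ring
        have h7 : 0 ≤ p * y := Nat.zero_le _
        omega
    · have : ((t : ℕ) : ℝ) < (y + 1 : ℕ) := by
        push_cast at hfull ⊢
        linarith
      have := Nat.mul_le_mul_left p (Nat.lt_succ_iff.1 (by exact_mod_cast this : t < y + 1))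
      omega
  refine ⟨key, ?_⟩
  rcases le_or_gt p x with h | h
  · have := key (Or.inl h)
    omega
  -- Interpolation between the extreme bins: `(p - x) * t + x * q ≤ (p - x) * τ + x * (τ - p * a) =
  -- p * (τ - x * a) < p * (y + 1)`.
  · have hp0 : (0 : ℝ) < p := by exact_mod_cast hp1
    have hpx : (0 : ℝ) ≤ p - x := by
      have : (x : ℝ) ≤ p := by exact_mod_cast h.le
      linarith
    have hd' : (t : ℝ) = q + d := by exact_mod_cast hd
    have h1 := mul_lt_mul_of_pos_left hfull hp0
    have h2 := mul_le_mul_of_nonneg_left ht hpx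
    have h3 := mul_le_mul_of_nonneg_left hq (Nat.cast_nonneg (α := ℝ) x)
    have h4 : (x : ℝ) * t = x * q + x * d := by rw [hd']; ring
    have : (p : ℝ) * t < d * x + p * y + p := by linarith
    exact_mod_cast this

/-- If a chore of the largest cost is left, every bin holds at least `p` chores of that cost. -/
lemma Serves.mul_lt_numLarge {v : Fin n → Fin m → ℝ} {τ : Fin n → ℝ} {i : Fin n} {k : ℕ}
    {U W : Finset (Fin m)} (h : Serves v τ i k U W) (hv : Antitone (v i)) {a : ℝ} (ha : 0 < a)
    (hva : ∀ c, v i c ≤ a) {p : ℕ} (hp : p * a ≤ τ i) {c : Fin m} (hca : v i c = a)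
    (hc : c ∈ W) : k * p < numLarge (v i) a U := by
  induction h with
  | zero U =>
    have : 0 < numLarge (v i) a U := Finset.card_pos.2 ⟨c, Finset.mem_filter.2 ⟨hc, hca⟩⟩
    simpa using this
  | succ k R U W hi h ih =>
    have hcU := Finset.mem_sdiff.1 (h.subset hc)
    have h1 := lt_numLarge_add_one_mul hi hv ha.le hva hca hcU.1 hcU.2
    have h2 : (p : ℝ) < (numLarge (v i) a (nextBin v τ R U) + 1 : ℕ) := by
      push_cast
      exact lt_of_mul_lt_mul_right (hp.trans_lt h1) ha.le
    have h3 : p < numLarge (v i) a (nextBin v τ R U) + 1 := by exact_mod_cast h2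
    have h4 := numLarge_add_sdiff (v i) a (nextBin_subset v τ R U)
    have := ih hc
    rw [Nat.succ_mul]
    omega

/-- If a small chore is left, the weight of the chores exceeds that of `k` full bins. -/
lemma Serves.mul_lt_weight {v : Fin n → Fin m → ℝ} {τ : Fin n → ℝ} {i : Fin n} {k : ℕ}
    {U W : Finset (Fin m)} (h : Serves v τ i k U W) (hv : Antitone (v i)) {a b : ℝ} (hb : 0 < b)
    (hba : b ≤ a) (hvab : ∀ c, v i c = a ∨ v i c = b) {p q t d : ℕ} (hp1 : 1 ≤ p)
    (hp : p * a ≤ τ i) (hp' : τ i < (p + 1) * a) (hq : q * b ≤ τ i - p * a) (ht : t * b ≤ τ i)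
    (ht' : τ i < (t + 1) * b) (hd : t = q + d) {c : Fin m} (hca : v i c ≠ a) (hc : c ∈ W) :
    k * (p * t) < d * numLarge (v i) a U + p * numSmall (v i) a U ∧
      (numLarge (v i) a U = 0 → k * (p * t) + p ≤ p * numSmall (v i) a U) := by
  have ha : 0 < a := hb.trans_le hba
  have hva : ∀ c, v i c ≤ a := fun c => (hvab c).elim (fun h => h.le) fun h => h.le.trans hba
  induction h with
  | zero U =>
    have : 0 < numSmall (v i) a U := Finset.card_pos.2 ⟨c, Finset.mem_filter.2 ⟨hc, hca⟩⟩
    have := Nat.le_mul_of_pos_right p this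
    constructor
    · omega
    · omega
  | succ k R U W hi h ih =>
    obtain ⟨ih1, ih2⟩ := ih hc
    have hcU := Finset.mem_sdiff.1 (h.subset hc)
    have hB := nextBin_subset v τ R U
    have hL := numLarge_add_sdiff (v i) a hB
    have hS := numSmall_add_sdiff (v i) a hB
    have hcost := lt_cost_nextBin_add hi
      (fun c => (hvab c).elim (fun h => h ▸ ha.le) fun h => h ▸ hb.le) hcU.1 hcU.2
    rw [cost_eq hvab, (hvab c).resolve_left hca] at hcost
    generalize hx : numLarge (v i) a (nextBin v τ R U) = x at *
    generalize numSmall (v i) a (nextBin v τ R U) = y at *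
    -- Dividing by `b` makes the small chores cost 1.
    obtain ⟨h1, h2⟩ := weight_of_full_bin (a := a / b) (τ := τ i / b) (x := x) (y := y)
      hp1 (by rw [← mul_div_assoc]; exact (div_lt_div_iff_of_pos_right hb).2 hp')
      (by rw [← mul_div_assoc, ← sub_div]; exact (le_div_iff₀ hb).2 hq) ((le_div_iff₀ hb).2 ht)
      ((div_lt_iff₀ hb).2 ht') hd (by
        rw [div_lt_iff₀ hb, add_mul, mul_assoc, div_mul_cancel₀ _ hb.ne']
        linarith)
    rw [← hL, ← hS, mul_add, mul_add, Nat.succ_mul]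
    generalize numSmall (v i) a (U \ nextBin v τ R U) = y' at *
    constructor
    · by_cases hcase : p ≤ x ∨ x = 0
      · have := h1 hcase
        omega
      -- Now `0 < x < p`. A large chore remaining after this bin would have been skipped, forcing `p
      -- ≤ x`; so the large chores have run out. This happens at most once, and the surplus `p` in
      -- `ih2` covers the loss.
      · have hx' : numLarge (v i) a (U \ nextBin v τ R U) = 0 := by
          by_contra hne
          obtain ⟨e, he⟩ := Finset.card_pos.1 (Nat.pos_of_ne_zero hne)
          rw [Finset.mem_filter, Finset.mem_sdiff] at he
          have h3 := lt_numLarge_add_one_mul hi hv ha.le hva he.2 he.1.1 he.1.2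
          rw [hx] at h3
          have h4 : (p : ℝ) < (x + 1 : ℕ) := by
            push_cast
            exact lt_of_mul_lt_mul_right (hp.trans_lt h3) ha.le
          have h5 : p < x + 1 := by exact_mod_cast h4
          omega
        have := ih2 hx'
        rw [hx']
        omega
    · intro h0
      have h3 := h1 (Or.inr (by omega))
      have h4 := ih2 (by omega)
      have hx0 : x = 0 := by omega
      rw [hx0] at h3
      omega

/-! ### Maximin share -/

lemma cost_le_mms_sup (d : ℕ) (w : Fin m → ℝ) (p : Fin m → Fin d) (j : Fin d) :
    cost w (Finset.univ.filter fun c => p c = j) ≤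
      ⨆ j : Fin d, cost w (Finset.univ.filter fun c => p c = j) :=
  le_ciSup (f := fun j : Fin d => cost w (Finset.univ.filter fun c => p c = j))
    (Set.finite_range _).bddAbove j

lemma exists_cost_le_mms {d : ℕ} (hd : 1 ≤ d) (w : Fin m → ℝ) :
    ∃ p : Fin m → Fin d, ∀ j, cost w (Finset.univ.filter fun c => p c = j) ≤ mms d w := by
  have : Nonempty (Fin d) := ⟨⟨0, hd⟩⟩
  obtain ⟨p, hp⟩ := exists_eq_ciInf_of_finite
    (f := fun p : Fin m → Fin d => ⨆ j, cost w (Finset.univ.filter fun c => p c = j))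
  refine ⟨p, fun j => (cost_le_mms_sup d w p j).trans ?_⟩
  rw [mms, ← hp]

lemma mms_le {d : ℕ} (hd : 1 ≤ d) {w : Fin m → ℝ} {x : ℝ} (p : Fin m → Fin d)
    (h : ∀ j, cost w (Finset.univ.filter fun c => p c = j) ≤ x) : mms d w ≤ x := by
  have : Nonempty (Fin d) := ⟨⟨0, hd⟩⟩
  exact (ciInf_le (Set.finite_range _).bddBelow p).trans (ciSup_le h)

lemma le_mms {d : ℕ} (hd : 1 ≤ d) {w : Fin m → ℝ} (hw : ∀ c, 0 ≤ w c) (c : Fin m) :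
    w c ≤ mms d w := by
  obtain ⟨p, hp⟩ := exists_cost_le_mms hd w
  refine le_trans ?_ (hp (p c))
  exact Finset.single_le_sum (f := w) (fun c _ => hw c) (by simp)

lemma mms_nonneg {d : ℕ} (hd : 1 ≤ d) {w : Fin m → ℝ} (hw : ∀ c, 0 ≤ w c) : 0 ≤ mms d w := by
  obtain ⟨p, hp⟩ := exists_cost_le_mms hd w
  exact (cost_nonneg hw _).trans (hp ⟨0, hd⟩)

lemma sum_numLarge_fiber (w : Fin m → ℝ) (a : ℝ) {d : ℕ} (p : Fin m → Fin d) :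
    ∑ j, numLarge w a (Finset.univ.filter fun c => p c = j) = numLarge w a Finset.univ := by
  rw [numLarge, Finset.card_eq_sum_card_fiberwise (f := p) (t := Finset.univ) (by simp)]
  refine Finset.sum_congr rfl fun j _ => ?_
  rw [numLarge, Finset.filter_filter, Finset.filter_filter]
  simp only [and_comm]

lemma sum_numSmall_fiber (w : Fin m → ℝ) (a : ℝ) {d : ℕ} (p : Fin m → Fin d) :
    ∑ j, numSmall w a (Finset.univ.filter fun c => p c = j) = numSmall w a Finset.univ := by
  rw [numSmall, Finset.card_eq_sum_card_fiberwise (f := p) (t := Finset.univ) (by simp)]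
  refine Finset.sum_congr rfl fun j _ => ?_
  rw [numSmall, Finset.filter_filter, Finset.filter_filter]
  simp only [and_comm]

/-- While an agent with a sufficient threshold remains, `n` bins hold all chores. -/
lemma not_serves_of_mms_le {v : Fin n → Fin m → ℝ} {τ : Fin n → ℝ} {i : Fin n} (hn : 1 ≤ n)
    (hv : Antitone (v i)) {a b : ℝ} (hb : 0 < b) (hba : b ≤ a)
    (hvab : ∀ c, v i c = a ∨ v i c = b) (hmem : ∃ c, v i c = a)
    (hτ : 15 / 13 * mms n (v i) ≤ τ i) {W : Finset (Fin m)} (hW : W.Nonempty) :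
    ¬ Serves v τ i n Finset.univ W := by
  intro h
  have ha : 0 < a := hb.trans_le hba
  have hva : ∀ c, v i c ≤ a := fun c => (hvab c).elim (fun h => h.le) fun h => h.le.trans hba
  have hv0 : ∀ c, 0 ≤ v i c := fun c => (hvab c).elim (fun h => h ▸ ha.le) fun h => h ▸ hb.le
  have hμ0 := mms_nonneg hn hv0
  have haτ : a ≤ τ i := by
    obtain ⟨c, hc⟩ := hmem
    have := le_mms hn hv0 c
    linarith
  have hτ0 : 0 ≤ τ i := ha.le.trans haτ
  -- `p`, `t` and `q` count the large chores that fit, the small chores that fit alone, and the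
  -- small chores that fit on top of `p` large ones.
  obtain ⟨p, hpdef⟩ : ∃ p, p = ⌊τ i / a⌋₊ := ⟨_, rfl⟩
  have hp : p * a ≤ τ i := by
    rw [hpdef, ← le_div_iff₀ ha]
    exact Nat.floor_le (div_nonneg hτ0 ha.le)
  have hp' : τ i < (p + 1) * a := by
    rw [hpdef, ← div_lt_iff₀ ha]
    exact Nat.lt_floor_add_one _
  have hp1 : 1 ≤ p := by
    rw [hpdef, Nat.one_le_floor_iff, le_div_iff₀ ha, one_mul]
    exact haτ
  obtain ⟨t, htdef⟩ : ∃ t, t = ⌊τ i / b⌋₊ := ⟨_, rfl⟩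
  have ht : t ≤ τ i / b := htdef ▸ Nat.floor_le (div_nonneg hτ0 hb.le)
  have ht' : τ i / b < t + 1 := htdef ▸ Nat.lt_floor_add_one _
  obtain ⟨q, hqdef⟩ : ∃ q, q = ⌊(τ i - p * a) / b⌋₊ := ⟨_, rfl⟩
  have hq : q ≤ (τ i - p * a) / b := hqdef ▸ Nat.floor_le (div_nonneg (by linarith) hb.le)
  have hq' : (τ i - p * a) / b < q + 1 := hqdef ▸ Nat.lt_floor_add_one _
  have hqt : q ≤ t := by
    rw [hqdef, htdef]
    refine Nat.floor_mono (div_le_div_of_nonneg_right ?_ hb.le)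
    have : 0 ≤ p * a := by positivity
    linarith
  obtain ⟨d, hd⟩ := Nat.exists_eq_add_of_le hqt
  obtain ⟨f, hf⟩ := exists_cost_le_mms hn (v i)
  have hbundle : ∀ j, numLarge (v i) a (Finset.univ.filter fun c => f c = j) * a
      + numSmall (v i) a (Finset.univ.filter fun c => f c = j) * b ≤ 13 / 15 * τ i := by
    intro j
    rw [← cost_eq hvab]
    linarith [hf j]
  obtain ⟨c, hc⟩ := hW
  by_cases hca : v i c = a
  · have h1 := h.mul_lt_numLarge hv ha hva hp hca hc
    rw [← sum_numLarge_fiber (v i) a f] at h1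
    have h2 : ∀ j ∈ Finset.univ,
        numLarge (v i) a (Finset.univ.filter fun c => f c = j) ≤ p := by
      intro j _
      rw [hpdef]
      refine Nat.le_floor ((le_div_iff₀ ha).2 ?_)
      have h3 := hbundle j
      have : 0 ≤ (numSmall (v i) a (Finset.univ.filter fun c => f c = j) : ℝ) * b := by positivity
      linarith
    have h3 := Finset.sum_le_card_nsmul _ _ _ h2
    simp only [Finset.card_univ, Fintype.card_fin, smul_eq_mul] at h3
    omega
  · have h1 := (h.mul_lt_weight hv hb hba hvab hp1 hp hp' ((le_div_iff₀ hb).1 hq)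
      ((le_div_iff₀ hb).1 ht) ((div_lt_iff₀ hb).1 ht') hd hca hc).1
    rw [← sum_numLarge_fiber (v i) a f, ← sum_numSmall_fiber (v i) a f, Finset.mul_sum,
      Finset.mul_sum, ← Finset.sum_add_distrib] at h1
    have h2 : ∀ j ∈ Finset.univ,
        d * numLarge (v i) a (Finset.univ.filter fun c => f c = j)
          + p * numSmall (v i) a (Finset.univ.filter fun c => f c = j) ≤ p * t := by
      intro j _
      have h3 := hbundle j
      generalize numLarge (v i) a (Finset.univ.filter fun c => f c = j) = x at *
      generalize numSmall (v i) a (Finset.univ.filter fun c => f c = j) = u at *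
      have h4 := weight_le_of_scaled (a := a / b) (τ := τ i / b) (p := p) (q := q) (t := t)
        (x := x) (u := u) ((one_le_div hb).2 hba)
        (by rw [← mul_div_assoc]; exact (div_lt_div_iff_of_pos_right hb).2 hp')
        (by rw [← mul_div_assoc, ← sub_div]; exact hq)
        (by rw [← mul_div_assoc, ← sub_div]; exact hq') ht'
        (by
          rw [le_div_iff₀ hb, mul_assoc, add_mul, mul_assoc (x : ℝ), div_mul_cancel₀ _ hb.ne']
          linarith)
      have h5 : t * x = q * x + d * x := by rw [hd]; ring
      omega
    have h3 := Finset.sum_le_card_nsmul _ _ _ h2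
    simp only [Finset.card_univ, Fintype.card_fin, smul_eq_mul] at h3
    omega

/-! ### Success on ordered instances -/

lemma IsPersonalizedBivalued.nonneg {v : Fin n → Fin m → ℝ} (h : IsPersonalizedBivalued v)
    (i : Fin n) (c : Fin m) : 0 ≤ v i c := by
  obtain ⟨a, b, ha, hb, hab⟩ := h i
  rcases hab c with h | h <;> rw [h] <;> positivity

/-- The larger one of the two values may be assumed to occur. -/
lemma IsPersonalizedBivalued.exists_le {v : Fin n → Fin m → ℝ} (h : IsPersonalizedBivalued v)
    (i : Fin n) (c₀ : Fin m) :
    ∃ a b : ℝ, 0 < b ∧ b ≤ a ∧ (∀ c, v i c = a ∨ v i c = b) ∧ ∃ c, v i c = a := by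
  obtain ⟨a, b, ha, hb, hab⟩ := h i
  wlog hba : b ≤ a generalizing a b
  · exact this b a hb ha (fun c => (hab c).symm) (le_of_not_ge hba)
  by_cases hc : ∃ c, v i c = a
  · exact ⟨a, b, hb, hba, hab, hc⟩
  · push Not at hc
    -- If only the smaller value occurs, it is used for both, and every chore counts as large.
    exact ⟨b, b, hb, le_rfl, fun c => Or.inl ((hab c).resolve_left (hc c)),
      c₀, (hab c₀).resolve_left (hc c₀)⟩

theorem HFFD.succeeds {v : Fin n → Fin m → ℝ} (hn : 1 ≤ n) (hbi : IsPersonalizedBivalued v)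
    (hido : IsIDO v) {τ : Fin n → ℝ} (hτ : ∀ i, 15 / 13 * mms n (v i) ≤ τ i)
    {A : Fin n → Finset (Fin m)} {W : Finset (Fin m)} (h : HFFD v τ A W) :
    W = ∅ ∧ IsAllocation A ∧ ∀ i, cost (v i) (A i) ≤ τ i := by
  have : Nonempty (Fin n) := ⟨⟨0, hn⟩⟩
  have hμ0 : ∀ i, 0 ≤ mms n (v i) := fun i => mms_nonneg hn (hbi.nonneg i)
  have hW : W = ∅ := by
    by_contra hne
    have hW := Finset.nonempty_iff_ne_empty.2 hne
    obtain ⟨i, -, hs⟩ := h.exists_serves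
      (fun i c => by linarith [hτ i, le_mms hn (hbi.nonneg i) c, hμ0 i]) hW Finset.univ_nonempty
    obtain ⟨a, b, hb, hba, hab, hmem⟩ := hbi.exists_le i hW.choose
    rw [Finset.card_univ, Fintype.card_fin] at hs
    exact not_serves_of_mms_le hn (hido i) hb hba hab hmem (hτ i) hW hs
  refine ⟨hW, fun c => h.existsUnique (Finset.mem_univ c) (by simp [hW]), fun i => ?_⟩
  rcases h.eq_empty_or_cost_le i with h0 | h0
  · rw [h0, cost_empty]
    linarith [hτ i, hμ0 i]
  · exact h0.2

/-! ### Unordered instances -/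

lemma exists_perm_antitone (w : Fin m → ℝ) : ∃ σ : Equiv.Perm (Fin m), Antitone (w ∘ σ) := by
  refine ⟨Tuple.sort fun c => -w c, fun x y hxy => ?_⟩
  have := Tuple.monotone_sort (fun c => -w c) hxy
  simpa using this

/-- Positions can be matched to chores that cost their owners no more than the positions do. -/
lemma exists_matching {v : Fin n → Fin m → ℝ} {σ : Fin n → Equiv.Perm (Fin m)}
    (hσ : ∀ i, Antitone (v i ∘ σ i)) (o : Fin m → Fin n) :
    ∃ π : Equiv.Perm (Fin m), ∀ k, v (o k) (π k) ≤ v (o k) (σ (o k) k) := by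
  obtain ⟨f, hinj, hf⟩ := (Finset.all_card_le_biUnion_card_iff_exists_injective
    fun k => Finset.univ.filter fun c => v (o k) c ≤ v (o k) (σ (o k) k)).1 (by
      intro T
      rcases T.eq_empty_or_nonempty with rfl | hT
      · simp
      -- Hall's condition: the owner of the earliest position `k` in `T` accepts, for `k`, every
      -- chore in that agent's own order from position `k` on, and there are at least `T.card` of
      -- these.
      · let k := T.min' hT
        calc T.card ≤ (Finset.Ici k).card :=
              Finset.card_le_card fun l hl => Finset.mem_Ici.2 (T.min'_le l hl)
          _ = ((Finset.Ici k).map (σ (o k)).toEmbedding).card := (Finset.card_map _).symm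
          _ ≤ _ := Finset.card_le_card fun c hc => by
              obtain ⟨l, hl, rfl⟩ := Finset.mem_map.1 hc
              refine Finset.mem_biUnion.2 ⟨k, T.min'_mem hT, ?_⟩
              exact Finset.mem_filter.2 ⟨Finset.mem_univ _, hσ (o k) (Finset.mem_Ici.1 hl)⟩)
  refine ⟨Equiv.ofBijective f (Finite.injective_iff_bijective.1 hinj), fun k => ?_⟩
  simpa using hf k

lemma mms_comp_perm_le {d : ℕ} (hd : 1 ≤ d) (w : Fin m → ℝ) (σ : Equiv.Perm (Fin m)) :
    mms d (w ∘ σ) ≤ mms d w := by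
  obtain ⟨p, hp⟩ := exists_cost_le_mms hd w
  refine mms_le hd (p ∘ σ) fun j => le_of_eq_of_le ?_ (hp j)
  rw [cost, cost, Finset.sum_filter, Finset.sum_filter]
  exact Equiv.sum_comp σ fun c => if p c = j then w c else 0

/-- HFFD runs on positions, each agent's costs being sorted separately. The matching replaces every
position by a chore no costlier to the owner of the position, and sorting does not raise the maximin
share. -/
theorem exists_isApproxMMS {v : Fin n → Fin m → ℝ} (hn : 1 ≤ n)
    (hbi : IsPersonalizedBivalued v) : ∃ A, IsAllocation A ∧ IsApproxMMS (15 / 13) v A := by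
  choose σ hσ using fun i => exists_perm_antitone (v i)
  have hbi' : IsPersonalizedBivalued fun i => v i ∘ σ i := fun i => by
    obtain ⟨a, b, ha, hb, hab⟩ := hbi i
    exact ⟨a, b, ha, hb, fun c => hab _⟩
  obtain ⟨A, W, hA⟩ := exists_hffdFrom (fun i => v i ∘ σ i)
    (fun i => 15 / 13 * mms n (v i ∘ σ i)) Finset.univ Finset.univ
  obtain ⟨-, halloc, hcost⟩ := HFFD.succeeds hn hbi' hσ (fun i => le_rfl) hA
  choose o ho huniq using halloc
  obtain ⟨π, hπ⟩ := exists_matching hσ o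
  refine ⟨fun i => (A i).map π.toEmbedding, fun c => ⟨o (π.symm c), ?_, fun i hi => ?_⟩,
    fun i => ?_⟩
  · exact Finset.mem_map.2 ⟨π.symm c, ho _, by simp⟩
  · obtain ⟨k, hk, rfl⟩ := Finset.mem_map.1 hi
    simpa using huniq k i hk
  · calc cost (v i) ((A i).map π.toEmbedding) = ∑ k ∈ A i, v i (π k) := by simp [cost]
      _ ≤ ∑ k ∈ A i, v i (σ i k) := Finset.sum_le_sum fun k hk => by
          have := hπ k
          rwa [← huniq k i hk] at this
      _ ≤ 15 / 13 * mms n (v i ∘ σ i) := hcost i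
      _ ≤ 15 / 13 * mms n (v i) := by linarith [mms_comp_perm_le hn (v i) (σ i)]

/-! ### Tightness -/

/-- Three chores of cost `4` and nine chores of cost `3`. -/
def tightCost (c : Fin 12) : ℝ := if c < 3 then 4 else 3

lemma tightCost_eq (c : Fin 12) : tightCost c = 4 ∨ tightCost c = 3 := by
  unfold tightCost
  split_ifs <;> simp

lemma tightCost_eq_four_iff (c : Fin 12) : tightCost c = 4 ↔ c < 3 := by
  unfold tightCost
  split_ifs with h <;> simp [h]

lemma tightCost_antitone : Antitone tightCost := by
  intro c d hcd
  unfold tightCost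
  split_ifs with h1 h2
  · exact le_rfl
  · exact absurd (hcd.trans_lt h1) h2
  · norm_num
  · exact le_rfl

lemma numLarge_tightCost (S : Finset (Fin 12)) :
    numLarge tightCost 4 S = (S.filter (· < 3)).card := by
  simp only [numLarge, tightCost_eq_four_iff]

lemma cost_tightCost (S : Finset (Fin 12)) :
    cost tightCost S = ((S.filter (· < 3)).card + 3 * S.card : ℕ) := by
  rw [cost_eq tightCost_eq, ← numLarge_tightCost, numLarge, numSmall,
    ← Finset.card_filter_add_card_filter_not (s := S) (fun c => tightCost c = 4)]
  push_cast
  ring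

lemma cost_tightCost_univ : cost tightCost Finset.univ = 39 := by
  rw [cost_tightCost]
  have : ((Finset.univ : Finset (Fin 12)).filter (· < 3)).card
    + 3 * (Finset.univ : Finset (Fin 12)).card = 39 := by decide
  exact_mod_cast this

lemma mms_tightCost : mms 3 tightCost = 13 := by
  apply le_antisymm
  -- Residues modulo 3 put one chore of cost 4 and three of cost 3 into each bundle.
  · refine mms_le (by norm_num) (fun c => ⟨c % 3, Nat.mod_lt _ (by norm_num)⟩) fun j => ?_
    rw [cost_tightCost]
    have : ∀ j : Fin 3, ((Finset.univ.filter fun c : Fin 12 =>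
        (⟨c % 3, Nat.mod_lt _ (by norm_num)⟩ : Fin 3) = j).filter (· < 3)).card
        + 3 * (Finset.univ.filter fun c : Fin 12 =>
        (⟨c % 3, Nat.mod_lt _ (by norm_num)⟩ : Fin 3) = j).card ≤ 13 := by decide
    exact_mod_cast this j
  · obtain ⟨p, hp⟩ := exists_cost_le_mms (d := 3) (by norm_num) tightCost
    have h : ∑ j, cost tightCost (Finset.univ.filter fun c => p c = j)
        = cost tightCost Finset.univ := Finset.sum_fiberwise _ p tightCost
    rw [Fin.sum_univ_three, cost_tightCost_univ] at h
    linarith [hp 0, hp 1, hp 2]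

lemma IsAllocation.sum_cost {A : Fin n → Finset (Fin m)} (h : IsAllocation A) (w : Fin m → ℝ) :
    ∑ i, cost w (A i) = cost w Finset.univ := by
  choose o ho huniq using h
  have hA : ∀ i, A i = Finset.univ.filter fun c => o c = i := fun i => by
    ext c
    rw [Finset.mem_filter]
    exact ⟨fun hc => ⟨Finset.mem_univ c, (huniq c i hc).symm⟩, fun hc => hc.2 ▸ ho c⟩
  simp only [hA]
  exact Finset.sum_fiberwise _ o w

/-- If the first bin contains all three 4s, every bundle cost is a multiple of 3. Bundles below 15
then cost at most 12 each, and 36 is less than the total of 39. -/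
lemma exists_le_cost_of_hffd {τ : Fin 3 → ℝ} {A : Fin 3 → Finset (Fin 12)}
    (h : HFFD (fun _ => tightCost) τ A ∅) : ∃ i, 15 ≤ cost tightCost (A i) := by
  by_contra! hlt
  have hsum := IsAllocation.sum_cost (fun c => h.existsUnique (Finset.mem_univ c) (by simp))
    tightCost
  rw [cost_tightCost_univ] at hsum
  obtain ⟨i₀, hi₀⟩ := Finite.exists_max τ
  -- The bundles cost 13 on average, so the largest threshold is at least 13.
  have hτ : 13 ≤ τ i₀ := by
    by_contra! hτ
    have : ∀ i ∈ Finset.univ, cost tightCost (A i) < 13 := fun i _ => by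
      rcases h.eq_empty_or_cost_le i with h0 | h0
      · rw [h0, cost_empty]
        norm_num
      · exact (h0.2.trans (hi₀ i)).trans_lt hτ
    have := Finset.sum_lt_sum_of_nonempty Finset.univ_nonempty this
    simp only [hsum, Finset.sum_const, Finset.card_univ, Fintype.card_fin] at this
    norm_num at this
  suffices h12 : ∀ i ∈ Finset.univ, cost tightCost (A i) ≤ 12 by
    have := Finset.sum_le_card_nsmul _ _ _ h12
    rw [hsum] at this
    norm_num at this
  unfold HFFD at h
  generalize hW : (∅ : Finset (Fin 12)) = W at h
  cases h with
  | halt => exact absurd hW.symm Finset.univ_nonempty.ne_empty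
  | step _ _ A _ i hi hne hfit h =>
    generalize hB : nextBin (fun _ : Fin 3 => tightCost) τ Finset.univ Finset.univ = B at *
    have h3 : ((Finset.univ : Finset (Fin 12)).filter (· < 3)).card = 3 := by decide
    -- The three 4s cost only 12, so they fit under the threshold of `i₀`, whoever receives the bin.
    have hsub : (Finset.univ : Finset (Fin 12)).filter (· < 3) ⊆ B := by
      intro c hc
      have hc3 := (Finset.mem_filter.1 hc).2
      by_contra hcB
      have h1 := lt_numLarge_add_one_mul (v := fun _ : Fin 3 => tightCost)
        (Finset.mem_univ i₀) tightCost_antitone (by norm_num : (0 : ℝ) ≤ 4)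
        (fun c => (tightCost_eq c).elim (fun h => h.le) fun h => by rw [h]; norm_num)
        ((tightCost_eq_four_iff c).2 hc3) (Finset.mem_univ c) (by rwa [hB])
      rw [hB, numLarge_tightCost] at h1
      have h2 : ((2 : ℕ) : ℝ) < (B.filter (· < 3)).card := by
        push_cast
        linarith
      have h4 : (B.filter (· < 3)).card < 3 := by
        rw [← h3]
        refine Finset.card_lt_card ⟨Finset.filter_subset_filter _ (Finset.subset_univ B), ?_⟩
        exact fun hle => hcB (Finset.mem_filter.1 (hle hc)).1
      have : 2 < (B.filter (· < 3)).card := by exact_mod_cast h2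
      omega
    intro j _
    have hj := hlt j
    rcases eq_or_ne j i with rfl | hji
    · rw [Function.update_self, cost_tightCost] at hj ⊢
      have h1 : B.filter (· < 3) = Finset.univ.filter (· < 3) :=
        (Finset.filter_subset_filter _ (Finset.subset_univ B)).antisymm fun c hc =>
          Finset.mem_filter.2 ⟨hsub hc, (Finset.mem_filter.1 hc).2⟩
      rw [h1, h3] at hj ⊢
      have h2 : 3 + 3 * B.card < 15 := by exact_mod_cast hj
      have h4 : 3 + 3 * B.card ≤ 12 := by omega
      exact_mod_cast h4
    · rw [Function.update_of_ne hji, cost_tightCost] at hj ⊢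
      have h1 : (A j).filter (· < 3) = ∅ := Finset.filter_eq_empty_iff.2 fun c hc hc3 =>
        (Finset.mem_sdiff.1 (h.subset.2 j hc)).2
          (hsub (Finset.mem_filter.2 ⟨Finset.mem_univ c, hc3⟩))
      rw [h1, Finset.card_empty, zero_add] at hj ⊢
      have h2 : 3 * (A j).card < 15 := by exact_mod_cast hj
      have h4 : 3 * (A j).card ≤ 12 := by omega
      exact_mod_cast h4

end Chores

theorem mainTheorem3 :
    -- On ordered instances, HFFD succeeds for all thresholds that are at least `15/13 * MMS`.
    (∀ (n m : ℕ) (v : Fin n → Fin m → ℝ), 1 ≤ n →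
      Chores.IsPersonalizedBivalued v → Chores.IsIDO v →
      ∀ τ : Fin n → ℝ, (∀ i, 15 / 13 * Chores.mms n (v i) ≤ τ i) →
        (∃ A W, Chores.HFFD v τ A W) ∧
        ∀ A W, Chores.HFFD v τ A W →
          W = ∅ ∧ Chores.IsAllocation A ∧ ∀ i, Chores.cost (v i) (A i) ≤ τ i) ∧
    -- In particular, with thresholds `15/13 * MMS`, every output is a `15/13`-MMS allocation.
    (∀ (n m : ℕ) (v : Fin n → Fin m → ℝ), 1 ≤ n →
      Chores.IsPersonalizedBivalued v → Chores.IsIDO v →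
        (∃ A W, Chores.HFFD v (fun i => 15 / 13 * Chores.mms n (v i)) A W) ∧
        ∀ A W, Chores.HFFD v (fun i => 15 / 13 * Chores.mms n (v i)) A W →
          W = ∅ ∧ Chores.IsAllocation A ∧ Chores.IsApproxMMS (15 / 13) v A) ∧
    -- Hence such an allocation exists for every instance, ordered or not.
    (∀ (n m : ℕ) (v : Fin n → Fin m → ℝ), 1 ≤ n →
      Chores.IsPersonalizedBivalued v →
        ∃ A, Chores.IsAllocation A ∧ Chores.IsApproxMMS (15 / 13) v A) ∧
    -- Tightness, for three agents with the same two-valued cost function.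
    (∃ (m : ℕ) (w : Fin m → ℝ) (a b : ℚ), 0 < a ∧ 0 < b ∧
      (∀ c, w c = (a : ℝ) ∨ w c = (b : ℝ)) ∧ Antitone w ∧
      (∀ τ : Fin 3 → ℝ, (∀ i, τ i < 15 / 13 * Chores.mms 3 w) →
        ∀ A W, Chores.HFFD (fun _ : Fin 3 => w) τ A W → W ≠ ∅) ∧
      (∀ (τ : Fin 3 → ℝ) (A : Fin 3 → Finset (Fin m)),
        Chores.HFFD (fun _ : Fin 3 => w) τ A ∅ →
          ∃ i, 15 / 13 * Chores.mms 3 w ≤ Chores.cost w (A i))) := by 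
  refine ⟨fun n m v hn hbi hido τ hτ => ⟨Chores.exists_hffdFrom _ _ _ _, fun A W h =>
      Chores.HFFD.succeeds hn hbi hido hτ h⟩,
    fun n m v hn hbi hido => ⟨Chores.exists_hffdFrom _ _ _ _, fun A W h =>
      Chores.HFFD.succeeds hn hbi hido (fun i => le_rfl) h⟩,
    fun n m v hn hbi => Chores.exists_isApproxMMS hn hbi,
    12, Chores.tightCost, 4, 3, by norm_num, by norm_num, by simpa using Chores.tightCost_eq,
    Chores.tightCost_antitone, ?_, ?_⟩
  all_goals
    rw [Chores.mms_tightCost, show (15 / 13 * 13 : ℝ) = 15 by norm_num]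
  · rintro τ hτ A W h rfl
    obtain ⟨i, hi⟩ := Chores.exists_le_cost_of_hffd h
    rcases h.eq_empty_or_cost_le i with h0 | h0
    · rw [h0, Chores.cost_empty] at hi
      norm_num at hi
    · exact absurd (hi.trans h0.2) (hτ i).not_ge
  · exact fun τ A h => Chores.exists_le_cost_of_hffd h
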